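/- Let $K$ be a field. A (directed) graph $G=(G^0,G^1,s,r)$ consists of sets of vertices and edges with source and range maps $s,r:G^1\to G^0$. Its double graph $\hat G$ has the same vertices and has, for every $e\in G^1$, the edge $e$ and a ghost edge $e^*$ from $r(e)$ to $s(e)$; a walk in $G$ is a (possibly trivial) path in $\hat G$. All graphs are assumed to have at least one vertex and to be connected, i.e. any two vertices are joined by a walk. Let $\dot E=(E,C,D)$ be a finitely bi-separated graph: $E$ is a graph, $C=\bigsqcup_{v\in E^0}C_v$ and $D=\bigsqcup_{v\in E^0}D_v$, where $C_v$ is a partition of $s^{-1}(v)$ and $D_v$ is a partition of $r^{-1}(v)$ into nonempty finite sets, and $|X\cap Y|\le 1$ for all $X\in C$, $Y\in D$. Put $XY=YX=e$ if $X\cap Y=\{e\}$ and $XY=YX=0$ if $X\cap Y=\emptyset$. For $X\in C$ (resp. $Y\in D$) let $s(X)$ (resp. $r(Y)$) be the common source (resp. range) of its edges. The Leavitt path algebra $L(\dot E)$ is the (associative, not necessarily unital) $K$-algebra generated by $E^0\cup\{e,e^*\mid e\in E^1\}$ subject to $uv=\delta_{uv}u$ for $u,v\in E^0$; $s(e)e=e=e\,r(e)$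 and $r(e)e^*=e^*=e^*s(e)$ for $e\in E^1$; and $$\sum_{Y\in D}(XY)(YX')^*=\delta_{XX'}s(X)\quad(X,X'\in C),\qquad \sum_{X\in C}(YX)^*(XY')=\delta_{YY'}r(Y)\quad(Y,Y'\in D),$$ where $0^*=0$. A representation graph for $\dot E$ is a pair $(F,\phi)$ of a graph $F$ and a graph homomorphism $\phi:F\to E$ such that for every $w\in F^0$ and every $X\in C_{\phi(w)}$ there is exactly one $f\in s^{-1}(w)$ with $\phi(f)\in X$, and for every $w\in F^0$ and every $Y\in D_{\phi(w)}$ there is exactly one $f\in r^{-1}(w)$ with $\phi(f)\in Y$. A morphism $(F,\phi)\to(G,\psi)$ is a graph homomorphism $\alpha:F\to G$ with $\psi\circ\alpha=\phi$; this defines the category $\operatorname{RG}(\dot E)$. The right $L(\dot E)$-module $V(F,\phi)$ is the $K$-vector space with basis $F^0$ on which $L(\dot E)$ acts as follows, for $w\in F^0$, $v\in E^0$, $e\in E^1$: $w.v=w$ if $\phi(w)=v$ and $w.v=0$ otherwise; $w.e=r(f)$ if there is an $f\in F^1$ with $s(f)=w$ and $\phi(f)=e$ (such an $f$ is unique), and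 $w.e=0$ otherwise; $w.e^*=s(f)$ if there is an $f\in F^1$ with $r(f)=w$ and $\phi(f)=e$ (such an $f$ is unique), and $w.e^*=0$ otherwise. A covering of a graph $F$ is a pair $(T,\tau)$ of a graph $T$ and a graph homomorphism $\tau:T\to F$ that restricts to bijections $s^{-1}(v)\to s^{-1}(\tau(v))$ and $r^{-1}(v)\to r^{-1}(\tau(v))$ for every $v\in T^0$. It is universal if for every covering $(P,\rho)$ of $F$ there is a graph homomorphism $\alpha:T\to P$ with $\rho\circ\alpha=\tau$. Let $\mathcal C$ be a connected component of $\operatorname{RG}(\dot E)$, let $(F,\phi)$ be any object of $\mathcal C$, let $(T,\tau)$ be any universal covering of $F$, and set $(T_{\mathcal C},\zeta_{\mathcal C})=(T,\phi\circ\tau)$, which is again a representation graph for $\dot E$. **Theorem.** The right $L(\dot E)$-module $V(T_{\mathcal C},\zeta_{\mathcal C})$ is indecomposable, i.e. it is nonzero and it is not the direct sum of two nonzero submodules. -/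

import Mathlib

universe u w

open CategoryTheory

/-! ## Directed graphs, walks, coverings -/

/-- A directed graph `(E⁰, E¹, s, r)`. -/
structure DirGraph : Type (u + 1) where
  /-- vertices -/
  Vert : Type u
  /-- edges -/
  Edge : Type u
  /-- source -/
  src : Edge → Vert
  /-- range -/
  rng : Edge → Vert

namespace DirGraph

/-- Paths in a directed graph, from one vertex to another. -/
inductive Path (G : DirGraph.{u}) : G.Vert → G.Vert → Type u
  | nil (v : G.Vert) : Path G v v
  | cons (e : G.Edge) {v : G.Vert} (p : Path G (G.rng e) v) : Path G (G.src e) v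

/-- The double graph: `Sum.inl e` is the edge `e`, and `Sum.inr e` is the ghost edge `e*`. -/
abbrev double (G : DirGraph.{u}) : DirGraph.{u} where
  Vert := G.Vert
  Edge := G.Edge ⊕ G.Edge
  src := Sum.elim G.src G.rng
  rng := Sum.elim G.rng G.src

/-- A walk in `G` is a path in the double graph of `G`. -/
abbrev Walk (G : DirGraph.{u}) (a b : G.Vert) : Type u := Path G.double a b

/-- The graph has at least one vertex, and any two vertices are joined by a walk. -/
def IsConnected (G : DirGraph.{u}) : Prop :=
  Nonempty G.Vert ∧ ∀ a b : G.Vert, Nonempty (G.Walk a b)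

/-- Graph homomorphisms. -/
@[ext]
structure Hom (F G : DirGraph.{u}) : Type u where
  /-- the map on vertices -/
  onVert : F.Vert → G.Vert
  /-- the map on edges -/
  onEdge : F.Edge → G.Edge
  src_onEdge : ∀ e, G.src (onEdge e) = onVert (F.src e)
  rng_onEdge : ∀ e, G.rng (onEdge e) = onVert (F.rng e)

/-- The identity homomorphism. -/
def Hom.id (G : DirGraph.{u}) : Hom G G where
  onVert := fun v => v
  onEdge := fun e => e
  src_onEdge := fun _ => rfl
  rng_onEdge := fun _ => rfl

/-- `β.comp α` is the composite `β ∘ α`. -/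
def Hom.comp {F G H : DirGraph.{u}} (β : Hom G H) (α : Hom F G) : Hom F H where
  onVert := fun v => β.onVert (α.onVert v)
  onEdge := fun e => β.onEdge (α.onEdge e)
  src_onEdge := fun e => by rw [β.src_onEdge, α.src_onEdge]
  rng_onEdge := fun e => by rw [β.rng_onEdge, α.rng_onEdge]

/-- A covering `(F, φ)` of `G`: `F` is connected (and nonempty), and `φ` restricts to bijections
`s⁻¹(v) → s⁻¹(φ v)` and `r⁻¹(v) → r⁻¹(φ v)` for every vertex `v` of `F`. -/
structure Covering (G : DirGraph.{u}) : Type (u + 1) where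
  /-- the total graph -/
  graph : DirGraph.{u}
  /-- the covering map -/
  hom : Hom graph G
  connected : graph.IsConnected
  bijOn_src : ∀ v : graph.Vert,
    Set.BijOn hom.onEdge (graph.src ⁻¹' {v}) (G.src ⁻¹' {hom.onVert v})
  bijOn_rng : ∀ v : graph.Vert,
    Set.BijOn hom.onEdge (graph.rng ⁻¹' {v}) (G.rng ⁻¹' {hom.onVert v})

/-- A covering is universal if it admits a morphism of coverings to every covering. -/
def Covering.IsUniversal {G : DirGraph.{u}} (T : Covering G) : Prop :=
  ∀ P : Covering G, ∃ α : Hom T.graph P.graph, P.hom.comp α = T.hom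

end DirGraph

/-! ## Bi-separated graphs and their Leavitt path algebras -/

/-- A (finitely) bi-separated graph `(E, C, D)` with `E` connected. -/
structure BiSepGraph : Type (u + 1) where
  /-- the underlying graph -/
  graph : DirGraph.{u}
  connected : graph.IsConnected
  /-- the partition `C_v` of `s⁻¹(v)` into nonempty blocks -/
  C : ∀ v : graph.Vert, Partition (graph.src ⁻¹' {v})
  /-- the partition `D_v` of `r⁻¹(v)` into nonempty blocks -/
  D : ∀ v : graph.Vert, Partition (graph.rng ⁻¹' {v})
  inter_subsingleton : ∀ v, ∀ X ∈ C v, ∀ v', ∀ Y ∈ D v', (X ∩ Y).Subsingleton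
  finite_C : ∀ v, ∀ X ∈ C v, X.Finite
  finite_D : ∀ v, ∀ Y ∈ D v, Y.Finite

namespace BiSepGraph

/-- The set `C`, the union of all the `C_v`. -/
def blocksC (S : BiSepGraph.{u}) : Set (Set S.graph.Edge) := {X | ∃ v, X ∈ S.C v}

/-- The set `D`, the union of all the `D_v`. -/
def blocksD (S : BiSepGraph.{u}) : Set (Set S.graph.Edge) := {Y | ∃ v, Y ∈ S.D v}

/-- The generators of the Leavitt path algebra: `Sum.inl v` for the vertices `v`, and
`Sum.inr x` for the edges `x` (that is, `e` and `e*`) of the double graph. -/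
abbrev Gen (S : BiSepGraph.{u}) : Type u := S.graph.Vert ⊕ S.graph.double.Edge

section

variable (K : Type w) [Field K] (S : BiSepGraph.{u})

/-- The generator `v`. -/
def gV (v : S.graph.Vert) : FreeAlgebra K S.Gen := FreeAlgebra.ι K (Sum.inl v)

/-- The generator `x`, an edge of the double graph. -/
def gX (x : S.graph.double.Edge) : FreeAlgebra K S.Gen := FreeAlgebra.ι K (Sum.inr x)

open Classical in
/-- The element `XY = YX`: it is `e` if `X ∩ Y = {e}`, and `0` if `X ∩ Y = ∅`. -/
noncomputable def meet (X Y : Set S.graph.Edge) : FreeAlgebra K S.Gen :=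
  if h : (X ∩ Y).Nonempty then S.gX K (Sum.inl h.some) else 0

open Classical in
/-- The element `(XY)* = (YX)*`: it is `e*` if `X ∩ Y = {e}`, and `0` if `X ∩ Y = ∅`. -/
noncomputable def meetStar (X Y : Set S.graph.Edge) : FreeAlgebra K S.Gen :=
  if h : (X ∩ Y).Nonempty then S.gX K (Sum.inr h.some) else 0

/-- The defining relations of the Leavitt path algebra: those of the path algebra of the double
graph, and the relations (L1) and (L2). All the sums have finite support, because blocks are
finite. -/
inductive Rel : FreeAlgebra K S.Gen → FreeAlgebra K S.Gen → Prop
  | vert_self (v : S.graph.Vert) : Rel (S.gV K v * S.gV K v) (S.gV K v)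
  | vert_ne (v v' : S.graph.Vert) (h : v ≠ v') : Rel (S.gV K v * S.gV K v') 0
  | src_mul (x : S.graph.double.Edge) : Rel (S.gV K (S.graph.double.src x) * S.gX K x) (S.gX K x)
  | mul_rng (x : S.graph.double.Edge) : Rel (S.gX K x * S.gV K (S.graph.double.rng x)) (S.gX K x)
  | L1_self (v : S.graph.Vert) (X : Set S.graph.Edge) (hX : X ∈ S.C v) :
      Rel (∑ᶠ Y ∈ S.blocksD, S.meet K X Y * S.meetStar K Y X) (S.gV K v)
  | L1_ne (X X' : Set S.graph.Edge) (hX : X ∈ S.blocksC) (hX' : X' ∈ S.blocksC) (h : X ≠ X') :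
      Rel (∑ᶠ Y ∈ S.blocksD, S.meet K X Y * S.meetStar K Y X') 0
  | L2_self (v : S.graph.Vert) (Y : Set S.graph.Edge) (hY : Y ∈ S.D v) :
      Rel (∑ᶠ X ∈ S.blocksC, S.meetStar K Y X * S.meet K X Y) (S.gV K v)
  | L2_ne (Y Y' : Set S.graph.Edge) (hY : Y ∈ S.blocksD) (hY' : Y' ∈ S.blocksD) (h : Y ≠ Y') :
      Rel (∑ᶠ X ∈ S.blocksC, S.meetStar K Y X * S.meet K X Y') 0

/-- The unital `K`-algebra with the presentation above. It is the unitization of the Leavitt path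
algebra, since no relation involves a constant term. -/
abbrev UnitalLPA : Type (max u w) := RingQuot (Rel K S)

/-- The Leavitt path algebra: the not necessarily unital `K`-algebra presented by the generators
and relations above, realized as the non-unital subalgebra generated by the generators inside the
unital algebra with the same presentation. -/
abbrev LPA : NonUnitalSubalgebra K (UnitalLPA K S) :=
  NonUnitalAlgebra.adjoin K
    (Set.range fun g : S.Gen => RingQuot.mkAlgHom K (Rel K S) (FreeAlgebra.ι K g))

end

end BiSepGraph

/-! ## Representation graphs -/

/-- A representation graph `(F, φ)` for a bi-separated graph. -/
structure RepGraph (S : BiSepGraph.{u}) : Type (u + 1) where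
  /-- the graph `F` -/
  graph : DirGraph.{u}
  connected : graph.IsConnected
  /-- the homomorphism `φ : F → E` -/
  hom : DirGraph.Hom graph S.graph
  existsUnique_src : ∀ w : graph.Vert, ∀ X ∈ S.C (hom.onVert w),
    ∃! f, graph.src f = w ∧ hom.onEdge f ∈ X
  existsUnique_rng : ∀ w : graph.Vert, ∀ Y ∈ S.D (hom.onVert w),
    ∃! f, graph.rng f = w ∧ hom.onEdge f ∈ Y

namespace RepGraph

variable {S : BiSepGraph.{u}}

/-- Morphisms `(F, φ) → (G, ψ)`: graph homomorphisms `α` with `ψ ∘ α = φ`. -/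
@[ext]
structure Mor (F G : RepGraph S) : Type u where
  /-- the graph homomorphism -/
  hom : DirGraph.Hom F.graph G.graph
  comp_eq : G.hom.comp hom = F.hom

/-- The category of representation graphs. -/
instance : Category.{u} (RepGraph S) where
  Hom := Mor
  id F := ⟨DirGraph.Hom.id F.graph, rfl⟩
  comp α β := ⟨β.hom.comp α.hom, by
    have h1 := α.comp_eq
    have h2 := β.comp_eq
    rw [← h1, ← h2]
    rfl⟩

/-- If `(F, φ)` is a representation graph and `(T, τ)` is a covering of `F`, then `(T, φ ∘ τ)` is
a representation graph. -/
def ofCovering (F : RepGraph S) (T : DirGraph.Covering F.graph) : RepGraph S where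
  graph := T.graph
  connected := T.connected
  hom := F.hom.comp T.hom
  existsUnique_src := by
    intro w X hX
    obtain ⟨g, ⟨hg, hgX⟩, hu⟩ := F.existsUnique_src (T.hom.onVert w) X hX
    obtain ⟨f, hf, hfg⟩ := (T.bijOn_src w).surjOn hg
    refine ⟨f, ⟨hf, by rw [← hfg] at hgX; exact hgX⟩, ?_⟩
    rintro f' ⟨hf', hfX⟩
    refine (T.bijOn_src w).injOn hf' hf ?_
    rw [hfg]
    exact hu _ ⟨(T.bijOn_src w).mapsTo hf', hfX⟩
  existsUnique_rng := by
    intro w X hX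
    obtain ⟨g, ⟨hg, hgX⟩, hu⟩ := F.existsUnique_rng (T.hom.onVert w) X hX
    obtain ⟨f, hf, hfg⟩ := (T.bijOn_rng w).surjOn hg
    refine ⟨f, ⟨hf, by rw [← hfg] at hgX; exact hgX⟩, ?_⟩
    rintro f' ⟨hf', hfX⟩
    refine (T.bijOn_rng w).injOn hf' hf ?_
    rw [hfg]
    exact hu _ ⟨(T.bijOn_rng w).mapsTo hf', hfX⟩

end RepGraph

/-! ## Right modules over non-unital rings -/

/-- The structure of a right module over a not necessarily unital ring `R` on an abelian group
`M`. -/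
structure RightModule (R : Type*) [NonUnitalRing R] (M : Type*) [AddCommGroup M] where
  /-- the action `m.a` -/
  act : M → R → M
  add_act : ∀ (m m' : M) (a : R), act (m + m') a = act m a + act m' a
  act_add : ∀ (m : M) (a b : R), act m (a + b) = act m a + act m b
  act_mul : ∀ (m : M) (a b : R), act m (a * b) = act (act m a) b

namespace RightModule

variable {R : Type*} [NonUnitalRing R] {M : Type*} [AddCommGroup M]

/-- An additive subgroup is a submodule if it is stable under the action. -/
def IsSubmodule (ρ : RightModule R M) (U : AddSubgroup M) : Prop :=
  ∀ m ∈ U, ∀ a : R, ρ.act m a ∈ U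

/-- A right module is indecomposable if it is nonzero and is not the (internal) direct sum of two
nonzero submodules. -/
def IsIndecomposable (ρ : RightModule R M) : Prop :=
  Nontrivial M ∧ ∀ U W : AddSubgroup M, ρ.IsSubmodule U → ρ.IsSubmodule W →
    IsCompl U W → U = ⊥ ∨ W = ⊥

end RightModule

/-! ## The module defined by a representation graph -/

namespace RepGraph

section

variable (K : Type w) [Field K] {S : BiSepGraph.{u}} (F : RepGraph S)

/-- The `K`-vector space with basis the vertices of `F`. -/
abbrev V : Type (max u w) := F.graph.Vert →₀ K

open Classical in
/-- `σ_v` sends a basis vector `w` to `w` if `φ(w) = v`, and to `0` otherwise. -/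
noncomputable def sigmaVert (v : S.graph.Vert) : Module.End K (F.V K) :=
  Finsupp.linearCombination K fun w =>
    if F.hom.onVert w = v then Finsupp.single w 1 else 0

open Classical in
/-- `σ_e` sends a basis vector `w` to `r(f)` if there is an edge `f` with `s(f) = w` and
`φ(f) = e`, and to `0` otherwise. Such an `f` is unique. -/
noncomputable def sigmaEdge (e : S.graph.Edge) : Module.End K (F.V K) :=
  Finsupp.linearCombination K fun w =>
    if h : ∃ f, F.graph.src f = w ∧ F.hom.onEdge f = e then
      Finsupp.single (F.graph.rng h.choose) 1 else 0

open Classical in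
/-- `σ_{e*}` sends a basis vector `w` to `s(f)` if there is an edge `f` with `r(f) = w` and
`φ(f) = e`, and to `0` otherwise. Such an `f` is unique. -/
noncomputable def sigmaStar (e : S.graph.Edge) : Module.End K (F.V K) :=
  Finsupp.linearCombination K fun w =>
    if h : ∃ f, F.graph.rng f = w ∧ F.hom.onEdge f = e then
      Finsupp.single (F.graph.src h.choose) 1 else 0

/-- The endomorphism attached to a generator. -/
noncomputable def sigma : S.Gen → Module.End K (F.V K)
  | Sum.inl v => F.sigmaVert K v
  | Sum.inr (Sum.inl e) => F.sigmaEdge K e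
  | Sum.inr (Sum.inr e) => F.sigmaStar K e

/-- The induced homomorphism from the free algebra to the opposite endomorphism algebra. -/
noncomputable def freeAction : FreeAlgebra K S.Gen →ₐ[K] (Module.End K (F.V K))ᵐᵒᵖ :=
  FreeAlgebra.lift K fun g => MulOpposite.op (F.sigma K g)

end

end RepGraph

/-! ## Auxiliary facts: the endomorphisms above satisfy the defining relations -/

namespace BiSepGraph

variable (S : BiSepGraph.{u})

theorem exists_mem_C (e : S.graph.Edge) : ∃ X ∈ S.C (S.graph.src e), e ∈ X := by
  have h : e ∈ sSup ((S.C (S.graph.src e) : Set (Set S.graph.Edge))) := by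
    rw [Partition.sSup_eq]; rfl
  exact Set.mem_sUnion.1 h

theorem exists_mem_D (e : S.graph.Edge) : ∃ Y ∈ S.D (S.graph.rng e), e ∈ Y := by
  have h : e ∈ sSup ((S.D (S.graph.rng e) : Set (Set S.graph.Edge))) := by
    rw [Partition.sSup_eq]; rfl
  exact Set.mem_sUnion.1 h

theorem src_of_mem {v : S.graph.Vert} {X : Set S.graph.Edge} (hX : X ∈ S.C v) {e : S.graph.Edge}
    (he : e ∈ X) : S.graph.src e = v := (S.C v).le_of_mem hX he

theorem rng_of_mem {v : S.graph.Vert} {Y : Set S.graph.Edge} (hY : Y ∈ S.D v) {e : S.graph.Edge}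
    (he : e ∈ Y) : S.graph.rng e = v := (S.D v).le_of_mem hY he

theorem blocksC_eq {X X' : Set S.graph.Edge} (hX : X ∈ S.blocksC) (hX' : X' ∈ S.blocksC)
    {e : S.graph.Edge} (he : e ∈ X) (he' : e ∈ X') : X = X' := by
  obtain ⟨v, hv⟩ := hX
  obtain ⟨v', hv'⟩ := hX'
  obtain rfl : v = v' := (S.src_of_mem hv he).symm.trans (S.src_of_mem hv' he')
  exact (S.C v).eq_of_not_disjoint hv hv' (Set.not_disjoint_iff.2 ⟨e, he, he'⟩)

theorem blocksD_eq {Y Y' : Set S.graph.Edge} (hY : Y ∈ S.blocksD) (hY' : Y' ∈ S.blocksD)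
    {e : S.graph.Edge} (he : e ∈ Y) (he' : e ∈ Y') : Y = Y' := by
  obtain ⟨v, hv⟩ := hY
  obtain ⟨v', hv'⟩ := hY'
  obtain rfl : v = v' := (S.rng_of_mem hv he).symm.trans (S.rng_of_mem hv' he')
  exact (S.D v).eq_of_not_disjoint hv hv' (Set.not_disjoint_iff.2 ⟨e, he, he'⟩)

theorem finite_meeting_D {X : Set S.graph.Edge} (hX : X ∈ S.blocksC) :
    {Y | Y ∈ S.blocksD ∧ (X ∩ Y).Nonempty}.Finite := by
  obtain ⟨v, hv⟩ := hX
  refine ((S.finite_C v X hv).biUnion (t := fun e => {Y | Y ∈ S.blocksD ∧ e ∈ Y})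
    fun e _ => Set.Subsingleton.finite
      fun Y hY Y' hY' => S.blocksD_eq hY.1 hY'.1 hY.2 hY'.2).subset ?_
  rintro Y ⟨hY, e, he, he'⟩
  exact Set.mem_biUnion he ⟨hY, he'⟩

theorem finite_meeting_C {Y : Set S.graph.Edge} (hY : Y ∈ S.blocksD) :
    {X | X ∈ S.blocksC ∧ (X ∩ Y).Nonempty}.Finite := by
  obtain ⟨v, hv⟩ := hY
  refine ((S.finite_D v Y hv).biUnion (t := fun e => {X | X ∈ S.blocksC ∧ e ∈ X})
    fun e _ => Set.Subsingleton.finite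
      fun Y hY Y' hY' => S.blocksC_eq hY.1 hY'.1 hY.2 hY'.2).subset ?_
  rintro X ⟨hX, e, he, he'⟩
  exact Set.mem_biUnion he' ⟨hX, he⟩

variable (K : Type w) [Field K]

theorem meet_eq_zero {X Y : Set S.graph.Edge} (h : ¬ (X ∩ Y).Nonempty) : S.meet K X Y = 0 :=
  dif_neg h

theorem meetStar_eq_zero {X Y : Set S.graph.Edge} (h : ¬ (X ∩ Y).Nonempty) :
    S.meetStar K X Y = 0 := dif_neg h

theorem meetStar_comm (X Y : Set S.graph.Edge) : S.meetStar K X Y = S.meetStar K Y X := by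
  unfold meetStar
  rw [Set.inter_comm]

theorem meet_eq {X Y : Set S.graph.Edge} (hX : X ∈ S.blocksC) (hY : Y ∈ S.blocksD)
    {e : S.graph.Edge} (he : e ∈ X) (he' : e ∈ Y) : S.meet K X Y = S.gX K (Sum.inl e) := by
  have h : (X ∩ Y).Nonempty := ⟨e, he, he'⟩
  obtain ⟨v, hv⟩ := hX
  obtain ⟨v', hv'⟩ := hY
  have h2 : h.some = e := S.inter_subsingleton v X hv v' Y hv' h.some_mem ⟨he, he'⟩
  unfold meet
  rw [dif_pos h, h2]

theorem meetStar_eq {X Y : Set S.graph.Edge} (hX : X ∈ S.blocksC) (hY : Y ∈ S.blocksD)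
    {e : S.graph.Edge} (he : e ∈ X) (he' : e ∈ Y) : S.meetStar K X Y = S.gX K (Sum.inr e) := by
  have h : (X ∩ Y).Nonempty := ⟨e, he, he'⟩
  obtain ⟨v, hv⟩ := hX
  obtain ⟨v', hv'⟩ := hY
  have h2 : h.some = e := S.inter_subsingleton v X hv v' Y hv' h.some_mem ⟨he, he'⟩
  unfold meetStar
  rw [dif_pos h, h2]

end BiSepGraph

namespace RepGraph

variable (K : Type w) [Field K] {S : BiSepGraph.{u}} (F : RepGraph S)

theorem src_inj {f f' : F.graph.Edge} {X : Set S.graph.Edge} (hX : X ∈ S.blocksC)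
    (hs : F.graph.src f = F.graph.src f') (h : F.hom.onEdge f ∈ X) (h' : F.hom.onEdge f' ∈ X) :
    f = f' := by
  obtain ⟨v, hv⟩ := hX
  have h1 := S.src_of_mem hv h
  rw [F.hom.src_onEdge] at h1
  subst h1
  exact (F.existsUnique_src _ X hv).unique ⟨rfl, h⟩ ⟨hs.symm, h'⟩

theorem rng_inj {f f' : F.graph.Edge} {Y : Set S.graph.Edge} (hY : Y ∈ S.blocksD)
    (hr : F.graph.rng f = F.graph.rng f') (h : F.hom.onEdge f ∈ Y) (h' : F.hom.onEdge f' ∈ Y) :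
    f = f' := by
  obtain ⟨v, hv⟩ := hY
  have h1 := S.rng_of_mem hv h
  rw [F.hom.rng_onEdge] at h1
  subst h1
  exact (F.existsUnique_rng _ Y hv).unique ⟨rfl, h⟩ ⟨hr.symm, h'⟩

theorem sigmaVert_single (v : S.graph.Vert) (w : F.graph.Vert) [Decidable (F.hom.onVert w = v)] :
    F.sigmaVert K v (Finsupp.single w 1) =
      if F.hom.onVert w = v then Finsupp.single w 1 else 0 := by
  unfold sigmaVert
  rw [Finsupp.linearCombination_single, one_smul]
  congr

theorem sigmaEdge_single (f : F.graph.Edge) :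
    F.sigmaEdge K (F.hom.onEdge f) (Finsupp.single (F.graph.src f) 1) =
      Finsupp.single (F.graph.rng f) 1 := by
  have h : ∃ f', F.graph.src f' = F.graph.src f ∧ F.hom.onEdge f' = F.hom.onEdge f := ⟨f, rfl, rfl⟩
  obtain ⟨X, hX, hfX⟩ := S.exists_mem_C (F.hom.onEdge f)
  have h2 : h.choose = f := F.src_inj ⟨_, hX⟩ h.choose_spec.1
    (by rw [h.choose_spec.2]; exact hfX) hfX
  unfold sigmaEdge
  rw [Finsupp.linearCombination_single, one_smul, dif_pos h, h2]

theorem sigmaStar_single (f : F.graph.Edge) :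
    F.sigmaStar K (F.hom.onEdge f) (Finsupp.single (F.graph.rng f) 1) =
      Finsupp.single (F.graph.src f) 1 := by
  have h : ∃ f', F.graph.rng f' = F.graph.rng f ∧ F.hom.onEdge f' = F.hom.onEdge f := ⟨f, rfl, rfl⟩
  obtain ⟨X, hX, hfX⟩ := S.exists_mem_D (F.hom.onEdge f)
  have h2 : h.choose = f := F.rng_inj ⟨_, hX⟩ h.choose_spec.1
    (by rw [h.choose_spec.2]; exact hfX) hfX
  unfold sigmaStar
  rw [Finsupp.linearCombination_single, one_smul, dif_pos h, h2]

theorem sigmaEdge_single_zero {e : S.graph.Edge} {w : F.graph.Vert}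
    (h : ¬ ∃ f, F.graph.src f = w ∧ F.hom.onEdge f = e) :
    F.sigmaEdge K e (Finsupp.single w 1) = 0 := by
  unfold sigmaEdge
  rw [Finsupp.linearCombination_single, one_smul, dif_neg h]

theorem sigmaStar_single_zero {e : S.graph.Edge} {w : F.graph.Vert}
    (h : ¬ ∃ f, F.graph.rng f = w ∧ F.hom.onEdge f = e) :
    F.sigmaStar K e (Finsupp.single w 1) = 0 := by
  unfold sigmaStar
  rw [Finsupp.linearCombination_single, one_smul, dif_neg h]

/-- The additive map `a ↦ w.a`, for a basis vector `w`. -/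
noncomputable def freeEval (m : F.V K) : FreeAlgebra K S.Gen →+ F.V K where
  toFun := fun a => (F.freeAction K a).unop m
  map_zero' := by simp
  map_add' := by simp

theorem freeEval_mul (m : F.V K) (a b : FreeAlgebra K S.Gen) :
    F.freeEval K m (a * b) = F.freeEval K (F.freeEval K m a) b := by
  simp [freeEval]

theorem freeEval_gV (m : F.V K) (v : S.graph.Vert) :
    F.freeEval K m (S.gV K v) = F.sigmaVert K v m := by
  simp [freeEval, freeAction, BiSepGraph.gV, sigma]

theorem freeEval_edge (m : F.V K) (e : S.graph.Edge) :
    F.freeEval K m (S.gX K (Sum.inl e)) = F.sigmaEdge K e m := by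
  simp [freeEval, freeAction, BiSepGraph.gX, sigma]

theorem freeEval_star (m : F.V K) (e : S.graph.Edge) :
    F.freeEval K m (S.gX K (Sum.inr e)) = F.sigmaStar K e m := by
  simp [freeEval, freeAction, BiSepGraph.gX, sigma]

theorem freeEval_zero_left (a : FreeAlgebra K S.Gen) : F.freeEval K 0 a = 0 := by
  simp [freeEval]

open Classical in
theorem term_L1 {X X' Y : Set S.graph.Edge} (hX : X ∈ S.blocksC) (hX' : X' ∈ S.blocksC)
    (hY : Y ∈ S.blocksD) (w : F.graph.Vert) :
    F.freeEval K (Finsupp.single w 1) (S.meet K X Y * S.meetStar K Y X') =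
      if X = X' ∧ ∃ f, F.graph.src f = w ∧ F.hom.onEdge f ∈ X ∧ F.hom.onEdge f ∈ Y then
        Finsupp.single w 1 else 0 := by
  rw [freeEval_mul, S.meetStar_comm]
  by_cases hf : ∃ f, F.graph.src f = w ∧ F.hom.onEdge f ∈ X ∧ F.hom.onEdge f ∈ Y
  · obtain ⟨f, rfl, hfX, hfY⟩ := hf
    rw [S.meet_eq K hX hY hfX hfY, freeEval_edge, sigmaEdge_single]
    by_cases hXX : X = X'
    · subst hXX
      rw [if_pos ⟨rfl, f, rfl, hfX, hfY⟩, S.meetStar_eq K hX hY hfX hfY, freeEval_star,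
        sigmaStar_single]
    · rw [if_neg fun h => hXX h.1]
      by_cases hne : (X' ∩ Y).Nonempty
      · obtain ⟨e, heX, heY⟩ := hne
        rw [S.meetStar_eq K hX' hY heX heY, freeEval_star]
        refine F.sigmaStar_single_zero K ?_
        rintro ⟨f', hr, rfl⟩
        obtain rfl := F.rng_inj hY hr heY hfY
        exact hXX (S.blocksC_eq hX hX' hfX heX)
      · rw [S.meetStar_eq_zero K hne, map_zero]
  · rw [if_neg fun h => hf h.2]
    by_cases hne : (X ∩ Y).Nonempty
    · obtain ⟨e, heX, heY⟩ := hne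
      rw [S.meet_eq K hX hY heX heY, freeEval_edge, F.sigmaEdge_single_zero K, freeEval_zero_left]
      rintro ⟨f, hs, rfl⟩
      exact hf ⟨f, hs, heX, heY⟩
    · rw [S.meet_eq_zero K hne, map_zero, freeEval_zero_left]

open Classical in
theorem term_L2 {Y Y' X : Set S.graph.Edge} (hY : Y ∈ S.blocksD) (hY' : Y' ∈ S.blocksD)
    (hX : X ∈ S.blocksC) (w : F.graph.Vert) :
    F.freeEval K (Finsupp.single w 1) (S.meetStar K Y X * S.meet K X Y') =
      if Y = Y' ∧ ∃ f, F.graph.rng f = w ∧ F.hom.onEdge f ∈ Y ∧ F.hom.onEdge f ∈ X then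
        Finsupp.single w 1 else 0 := by
  rw [freeEval_mul, S.meetStar_comm]
  by_cases hf : ∃ f, F.graph.rng f = w ∧ F.hom.onEdge f ∈ Y ∧ F.hom.onEdge f ∈ X
  · obtain ⟨f, rfl, hfY, hfX⟩ := hf
    rw [S.meetStar_eq K hX hY hfX hfY, freeEval_star, sigmaStar_single]
    by_cases hYY : Y = Y'
    · subst hYY
      rw [if_pos ⟨rfl, f, rfl, hfY, hfX⟩, S.meet_eq K hX hY hfX hfY, freeEval_edge,
        sigmaEdge_single]
    · rw [if_neg fun h => hYY h.1]
      by_cases hne : (X ∩ Y').Nonempty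
      · obtain ⟨e, heX, heY⟩ := hne
        rw [S.meet_eq K hX hY' heX heY, freeEval_edge]
        refine F.sigmaEdge_single_zero K ?_
        rintro ⟨f', hr, rfl⟩
        obtain rfl := F.src_inj hX hr heX hfX
        exact hYY (S.blocksD_eq hY hY' hfY heY)
      · rw [S.meet_eq_zero K hne, map_zero]
  · rw [if_neg fun h => hf h.2]
    by_cases hne : (X ∩ Y).Nonempty
    · obtain ⟨e, heX, heY⟩ := hne
      rw [S.meetStar_eq K hX hY heX heY, freeEval_star, F.sigmaStar_single_zero K,
        freeEval_zero_left]
      rintro ⟨f, hs, rfl⟩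
      exact hf ⟨f, hs, heY, heX⟩
    · rw [S.meetStar_eq_zero K hne, map_zero, freeEval_zero_left]

open Classical in
theorem sum_L1 {X X' : Set S.graph.Edge} (hX : X ∈ S.blocksC) (hX' : X' ∈ S.blocksC)
    (w : F.graph.Vert) :
    F.freeEval K (Finsupp.single w 1) (∑ᶠ Y ∈ S.blocksD, S.meet K X Y * S.meetStar K Y X') =
      if X = X' ∧ X ∈ S.C (F.hom.onVert w) then Finsupp.single w 1 else 0 := by
  rw [AddMonoidHom.map_finsum_mem']
  swap
  · refine (S.finite_meeting_D hX).subset ?_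
    rintro Y ⟨hY, h⟩
    refine ⟨hY, ?_⟩
    by_contra hne
    exact h (by simp only [S.meet_eq_zero K hne, zero_mul])
  rw [finsum_mem_congr rfl fun Y hY => F.term_L1 K hX hX' hY w]
  by_cases h : X = X' ∧ X ∈ S.C (F.hom.onVert w)
  · obtain ⟨rfl, hw⟩ := h
    rw [if_pos ⟨rfl, hw⟩]
    obtain ⟨f, ⟨rfl, hfX⟩, -⟩ := F.existsUnique_src w X hw
    obtain ⟨Y, hY, hfY⟩ := S.exists_mem_D (F.hom.onEdge f)
    have hYD : Y ∈ S.blocksD := ⟨_, hY⟩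
    rw [finsum_eq_single _ Y]
    · rw [finsum_eq_if, if_pos hYD, if_pos ⟨rfl, f, rfl, hfX, hfY⟩]
    · intro Y' hne
      rw [finsum_eq_if]
      refine ite_eq_right_iff.2 fun hY' => if_neg ?_
      rintro ⟨-, f', hs, hfX', hfY'⟩
      obtain rfl := F.src_inj hX hs hfX' hfX
      exact hne (S.blocksD_eq hY' hYD hfY' hfY)
  · rw [if_neg h]
    refine finsum_mem_of_eqOn_zero fun Y _ => if_neg ?_
    rintro ⟨rfl, f, rfl, hfX, -⟩
    obtain ⟨v, hv⟩ := hX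
    have hs := S.src_of_mem hv hfX
    rw [F.hom.src_onEdge] at hs
    subst hs
    exact h ⟨rfl, hv⟩

open Classical in
theorem sum_L2 {Y Y' : Set S.graph.Edge} (hY : Y ∈ S.blocksD) (hY' : Y' ∈ S.blocksD)
    (w : F.graph.Vert) :
    F.freeEval K (Finsupp.single w 1) (∑ᶠ X ∈ S.blocksC, S.meetStar K Y X * S.meet K X Y') =
      if Y = Y' ∧ Y ∈ S.D (F.hom.onVert w) then Finsupp.single w 1 else 0 := by
  rw [AddMonoidHom.map_finsum_mem']
  swap
  · refine (S.finite_meeting_C hY).subset ?_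
    rintro X ⟨hX, h⟩
    refine ⟨hX, ?_⟩
    by_contra hne
    exact h (by simp only [S.meetStar_comm K Y X, S.meetStar_eq_zero K hne, zero_mul])
  rw [finsum_mem_congr rfl fun X hX => F.term_L2 K hY hY' hX w]
  by_cases h : Y = Y' ∧ Y ∈ S.D (F.hom.onVert w)
  · obtain ⟨rfl, hw⟩ := h
    rw [if_pos ⟨rfl, hw⟩]
    obtain ⟨f, ⟨rfl, hfY⟩, -⟩ := F.existsUnique_rng w Y hw
    obtain ⟨X, hX, hfX⟩ := S.exists_mem_C (F.hom.onEdge f)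
    have hXC : X ∈ S.blocksC := ⟨_, hX⟩
    rw [finsum_eq_single _ X]
    · rw [finsum_eq_if, if_pos hXC, if_pos ⟨rfl, f, rfl, hfY, hfX⟩]
    · intro X' hne
      rw [finsum_eq_if]
      refine ite_eq_right_iff.2 fun hX' => if_neg ?_
      rintro ⟨-, f', hs, hfY', hfX'⟩
      obtain rfl := F.rng_inj hY hs hfY' hfY
      exact hne (S.blocksC_eq hX' hXC hfX' hfX)
  · rw [if_neg h]
    refine finsum_mem_of_eqOn_zero fun X _ => if_neg ?_
    rintro ⟨rfl, f, rfl, hfY, -⟩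
    obtain ⟨v, hv⟩ := hY
    have hs := S.rng_of_mem hv hfY
    rw [F.hom.rng_onEdge] at hs
    subst hs
    exact h ⟨rfl, hv⟩

theorem mem_C_iff {v v' : S.graph.Vert} {X : Set S.graph.Edge} (hX : X ∈ S.C v) :
    X ∈ S.C v' ↔ v' = v := by
  refine ⟨fun h => ?_, fun h => h ▸ hX⟩
  obtain ⟨e, he⟩ := Set.nonempty_iff_ne_empty.2 ((S.C v).ne_bot_of_mem hX)
  exact (S.src_of_mem h he).symm.trans (S.src_of_mem hX he)

theorem mem_D_iff {v v' : S.graph.Vert} {Y : Set S.graph.Edge} (hY : Y ∈ S.D v) :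
    Y ∈ S.D v' ↔ v' = v := by
  refine ⟨fun h => ?_, fun h => h ▸ hY⟩
  obtain ⟨e, he⟩ := Set.nonempty_iff_ne_empty.2 ((S.D v).ne_bot_of_mem hY)
  exact (S.rng_of_mem h he).symm.trans (S.rng_of_mem hY he)

theorem freeAction_rel {a b : FreeAlgebra K S.Gen} (h : BiSepGraph.Rel K S a b) :
    F.freeAction K a = F.freeAction K b := by
  classical
  suffices H : ∀ w, F.freeEval K (Finsupp.single w 1) a = F.freeEval K (Finsupp.single w 1) b by
    apply MulOpposite.unop_injective
    refine Finsupp.lhom_ext' fun w => LinearMap.ext_ring ?_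
    exact H w
  intro w
  cases h with
  | vert_self v =>
    rw [freeEval_mul, F.freeEval_gV K (Finsupp.single w 1), sigmaVert_single]
    split_ifs with h
    · rw [freeEval_gV, sigmaVert_single, if_pos h]
    · rw [freeEval_zero_left]
  | vert_ne v v' hne =>
    rw [freeEval_mul, F.freeEval_gV K (Finsupp.single w 1), sigmaVert_single, map_zero]
    split_ifs with h
    · rw [freeEval_gV, sigmaVert_single, if_neg fun h' => hne (h.symm.trans h')]
    · rw [freeEval_zero_left]
  | src_mul x =>
    rw [freeEval_mul, freeEval_gV, sigmaVert_single]
    split_ifs with h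
    · rfl
    · rw [freeEval_zero_left]
      rcases x with e | e
      · rw [freeEval_edge, F.sigmaEdge_single_zero K]
        rintro ⟨f, rfl, rfl⟩
        exact h (F.hom.src_onEdge f).symm
      · rw [freeEval_star, F.sigmaStar_single_zero K]
        rintro ⟨f, rfl, rfl⟩
        exact h (F.hom.rng_onEdge f).symm
  | mul_rng x =>
    rw [freeEval_mul]
    rcases x with e | e
    · rw [freeEval_edge]
      by_cases hf : ∃ f, F.graph.src f = w ∧ F.hom.onEdge f = e
      · obtain ⟨f, rfl, rfl⟩ := hf
        rw [sigmaEdge_single, freeEval_gV, sigmaVert_single, if_pos]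
        exact (F.hom.rng_onEdge f).symm
      · rw [F.sigmaEdge_single_zero K hf, freeEval_zero_left]
    · rw [freeEval_star]
      by_cases hf : ∃ f, F.graph.rng f = w ∧ F.hom.onEdge f = e
      · obtain ⟨f, rfl, rfl⟩ := hf
        rw [sigmaStar_single, freeEval_gV, sigmaVert_single, if_pos]
        exact (F.hom.src_onEdge f).symm
      · rw [F.sigmaStar_single_zero K hf, freeEval_zero_left]
  | L1_self v X hX =>
    rw [F.sum_L1 K ⟨v, hX⟩ ⟨v, hX⟩, freeEval_gV, sigmaVert_single]
    simp only [true_and, mem_C_iff hX]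
  | L1_ne X X' hX hX' hne =>
    rw [F.sum_L1 K hX hX', if_neg fun h => hne h.1, map_zero]
  | L2_self v Y hY =>
    rw [F.sum_L2 K ⟨v, hY⟩ ⟨v, hY⟩, freeEval_gV, sigmaVert_single]
    simp only [true_and, mem_D_iff hY]
  | L2_ne Y Y' hY hY' hne =>
    rw [F.sum_L2 K hY hY', if_neg fun h => hne h.1, map_zero]

/-! ## The right module structure -/

/-- The homomorphism `π` into the opposite endomorphism algebra, with `π(v) = σ_v`, `π(e) = σ_e`
and `π(e*) = σ_{e*}`. -/
noncomputable def action : BiSepGraph.UnitalLPA K S →ₐ[K] (Module.End K (F.V K))ᵐᵒᵖ :=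
  RingQuot.liftAlgHom K ⟨F.freeAction K, fun _ _ h => F.freeAction_rel K h⟩

/-- The right module over the Leavitt path algebra defined by `(F, φ)`: `x.a = π(a)(x)`. -/
noncomputable def moduleV : RightModule (BiSepGraph.LPA K S) (F.V K) where
  act := fun m a => (F.action K a).unop m
  add_act := fun m m' a => map_add _ m m'
  act_add := fun m a b => by simp
  act_mul := fun m a b => by simp

end RepGraph

/-! Let `X` be the free group on the edges of `E`. The plan is to embed `V(T, φ ∘ τ)` in the group
algebra `K[X]` so that module endomorphisms become left multiplications. A direct sum decomposition
yields an idempotent endomorphism, hence an idempotent of `K[X]`. Since `K[X]` has no zero divisors,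
that idempotent is `0` or `1`, and one summand vanishes.

The embedding comes from a potential `p : T⁰ → X`, a function that is multiplied on the right by the
label `φ(τ(f))` along each edge `f`. Universality maps `T` to a component of the skew product of `F`
with `X`, and `p` is the group coordinate (`Covering.IsUniversal.exists_potential`). It is
injective: edges at a vertex of `T` with the same direction have distinct labels, so freely reducing
the word of a walk preserves its endpoints, and a walk whose word is trivial in `X` is closed
(`IsConnected.potential_injective`).

An endomorphism commutes with the partial translations `σ_e` and `σ_{e*}`. As `T` is connected, its
value at one vertex determines it, and `exists_toGroupAlgebra_eq_mul` follows. The absence of zero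
divisors rests on unique products in `X`, which hold because every nontrivial subgroup of a free
group is free and so maps nontrivially to `ℤ`. -/

/-! ## Unique products in free groups -/

/-- A group all of whose nontrivial subgroups admit a nontrivial homomorphism to `ℤ` has unique
products. -/
theorem UniqueProds.of_indicable {G : Type*} [Group G]
    (hG : ∀ H : Subgroup G, H ≠ ⊥ → ∃ χ : H →* Multiplicative ℤ, χ ≠ 1) : UniqueProds G := by
  classical
  refine ⟨fun {A B} hA hB => ?_⟩
  induction hn : A.card + B.card using Nat.strong_induction_on generalizing A B with
  | _ n ih =>
    subst hn
    by_cases h1 : A.card ≤ 1 ∧ B.card ≤ 1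
    · exact UniqueMul.of_card_le_one hA hB h1.1 h1.2
    obtain ⟨a₀, ha₀⟩ := hA
    obtain ⟨b₀, hb₀⟩ := hB
    -- Translating `A` on the left and `B` on the right does not affect uniqueness of products and
    -- puts `1` in both sets. The subgroup they generate is nontrivial because one of the sets has
    -- two elements.
    let Z : Set G := (fun a => a₀⁻¹ * a) '' A ∪ (fun b => b * b₀⁻¹) '' B
    let H := Subgroup.closure Z
    have hAH : ∀ a ∈ A, a₀⁻¹ * a ∈ H := fun a ha =>
      Subgroup.subset_closure (Or.inl ⟨a, ha, rfl⟩)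
    have hBH : ∀ b ∈ B, b * b₀⁻¹ ∈ H := fun b hb =>
      Subgroup.subset_closure (Or.inr ⟨b, hb, rfl⟩)
    have hH : H ≠ ⊥ := by
      intro h
      refine h1 ⟨?_, ?_⟩
      · refine Finset.card_le_one_iff_subset_singleton.2 ⟨a₀, fun a ha => ?_⟩
        have := hAH a ha
        rw [h, Subgroup.mem_bot, inv_mul_eq_one] at this
        exact Finset.mem_singleton.2 this.symm
      · refine Finset.card_le_one_iff_subset_singleton.2 ⟨b₀, fun b hb => ?_⟩
        have := hBH b hb
        rw [h, Subgroup.mem_bot, mul_inv_eq_one] at this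
        exact Finset.mem_singleton.2 this
    obtain ⟨χ, hχ⟩ := hG H hH
    -- The value `0` off `H` is junk: `c` is evaluated only on `H`.
    let c : G → ℤ := fun g => if h : g ∈ H then (χ ⟨g, h⟩).toAdd else 0
    have c_mul : ∀ g g', g ∈ H → g' ∈ H → c (g * g') = c g + c g' := by
      intro g g' hg hg'
      have : χ ⟨g * g', mul_mem hg hg'⟩ = χ ⟨g, hg⟩ * χ ⟨g', hg'⟩ := by
        rw [← map_mul]; rfl
      simp only [c, dif_pos hg, dif_pos hg', dif_pos (mul_mem hg hg'), this, toAdd_mul]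
    have c_one : c 1 = 0 := by simpa using c_mul 1 1 (one_mem H) (one_mem H)
    obtain ⟨a₁, ha₁, hmaxA⟩ := A.exists_max_image (fun a => c (a₀⁻¹ * a)) ⟨a₀, ha₀⟩
    obtain ⟨b₁, hb₁, hmaxB⟩ := B.exists_max_image (fun b => c (b * b₀⁻¹)) ⟨b₀, hb₀⟩
    -- The top levels of the two translated sets; a unique product of these stays unique in the full
    -- sets.
    let A' := A.filter fun a => c (a₀⁻¹ * a) = c (a₀⁻¹ * a₁)
    let B' := B.filter fun b => c (b * b₀⁻¹) = c (b₁ * b₀⁻¹)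
    have hA' : A' ⊆ A := Finset.filter_subset _ _
    have hB' : B' ⊆ B := Finset.filter_subset _ _
    -- If nothing were discarded, `c` would be constant on each translated set, hence `0` there
    -- because `1` belongs to both; then `χ` would be trivial on generators of `H`.
    have hlt : A'.card + B'.card < A.card + B.card := by
      by_contra hge
      have hA2 := Finset.card_le_card hA'
      have hB2 := Finset.card_le_card hB'
      have hAe : A' = A := Finset.eq_of_subset_of_card_le hA' (by omega)
      have hBe : B' = B := Finset.eq_of_subset_of_card_le hB' (by omega)
      have kA : ∀ a ∈ A, c (a₀⁻¹ * a) = 0 := by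
        intro a ha
        have e1 := (Finset.mem_filter.1 (hAe.symm ▸ ha : a ∈ A')).2
        have e2 := (Finset.mem_filter.1 (hAe.symm ▸ ha₀ : a₀ ∈ A')).2
        rw [e1, ← e2, inv_mul_cancel, c_one]
      have kB : ∀ b ∈ B, c (b * b₀⁻¹) = 0 := by
        intro b hb
        have e1 := (Finset.mem_filter.1 (hBe.symm ▸ hb : b ∈ B')).2
        have e2 := (Finset.mem_filter.1 (hBe.symm ▸ hb₀ : b₀ ∈ B')).2
        rw [e1, ← e2, mul_inv_cancel, c_one]
      refine hχ (MonoidHom.eq_of_eqOn_dense (Subgroup.closure_closure_coe_preimage (k := Z)) ?_)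
      rintro ⟨z, hzH⟩ hz
      have hz0 : c z = 0 := by
        rcases hz with ⟨a, ha, rfl⟩ | ⟨b, hb, rfl⟩
        · exact kA a ha
        · exact kB b hb
      simp only [c] at hz0
      rw [dif_pos hzH] at hz0
      exact hz0
    obtain ⟨a, ha, b, hb, hab⟩ := ih _ hlt (A := A') (B := B')
      ⟨a₁, Finset.mem_filter.2 ⟨ha₁, rfl⟩⟩ ⟨b₁, Finset.mem_filter.2 ⟨hb₁, rfl⟩⟩ rfl
    obtain ⟨haA, hac⟩ := Finset.mem_filter.1 ha
    obtain ⟨hbB, hbc⟩ := Finset.mem_filter.1 hb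
    refine ⟨a, haA, b, hbB, fun x y hx hy hxy => ?_⟩
    -- Both terms on the right are maximal, so equality of the sums forces `x` and `y` into the top
    -- levels.
    have key : c (a₀⁻¹ * x) + c (y * b₀⁻¹) = c (a₀⁻¹ * a) + c (b * b₀⁻¹) := by
      rw [← c_mul _ _ (hAH x hx) (hBH y hy), ← c_mul _ _ (hAH a haA) (hBH b hbB)]
      congr 1
      simp only [mul_assoc]
      rw [← mul_assoc x, hxy, mul_assoc]
    have m1 := hmaxA x hx
    have m2 := hmaxB y hy
    exact hab (Finset.mem_filter.2 ⟨hx, by omega⟩) (Finset.mem_filter.2 ⟨hy, by omega⟩) hxy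

/-- By Nielsen–Schreier each subgroup is free. Sending all its free generators to `1 ∈ ℤ` gives a
trivial map only if there are no generators, that is, only for the trivial subgroup. -/
instance FreeGroup.instUniqueProds {X : Type u} : UniqueProds (FreeGroup X) := by
  refine UniqueProds.of_indicable fun H hH => ?_
  refine ⟨IsFreeGroup.lift fun _ => Multiplicative.ofAdd 1, fun h => hH ?_⟩
  have hempty : IsEmpty (IsFreeGroup.Generators H) := by
    refine ⟨fun x => ?_⟩
    have := DFunLike.congr_fun h (IsFreeGroup.of x)
    rw [IsFreeGroup.lift_of] at this
    exact one_ne_zero (α := ℤ) this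
  rw [Subgroup.eq_bot_iff_forall]
  intro g hg
  have h1 : MonoidHom.id H = 1 := IsFreeGroup.ext_hom fun x => isEmptyElim x
  exact congrArg Subtype.val (DFunLike.congr_fun h1 ⟨g, hg⟩)

/-! ## Walks, components and potentials -/

namespace DirGraph

variable {G : DirGraph.{u}}

theorem Path.induction_rel {r : G.Vert → G.Vert → Prop} (nil : ∀ v, r v v)
    (cons : ∀ e v, r (G.rng e) v → r (G.src e) v) {a b : G.Vert} (p : G.Path a b) : r a b := by
  induction p with
  | nil => exact nil _
  | cons e _ ih => exact cons e _ ih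

theorem Walk.induction_rel {r : G.Vert → G.Vert → Prop} (nil : ∀ v, r v v)
    (edge : ∀ e v, r (G.rng e) v → r (G.src e) v) (ghost : ∀ e v, r (G.src e) v → r (G.rng e) v)
    {a b : G.Vert} (p : G.Walk a b) : r a b :=
  Path.induction_rel (G := G.double) nil (Sum.rec edge ghost) p

/-- The tool for spreading a fact from a base vertex over a connected graph. -/
theorem Walk.iff_of_edge {Q : G.Vert → Prop} (hQ : ∀ e, Q (G.src e) ↔ Q (G.rng e))
    {a b : G.Vert} (p : G.Walk a b) : Q a ↔ Q b :=
  Walk.induction_rel (r := fun a b => Q a ↔ Q b) (fun _ => Iff.rfl)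
    (fun e _ h => (hQ e).trans h) (fun e _ h => (hQ e).symm.trans h) p

theorem Walk.nonempty_trans {a b c : G.Vert} (p : G.Walk a b) (hq : Nonempty (G.Walk b c)) :
    Nonempty (G.Walk a c) :=
  Walk.induction_rel (r := fun a b => Nonempty (G.Walk b c) → Nonempty (G.Walk a c))
    (fun _ h => h) (fun e _ h h' => (h h').map (Path.cons (G := G.double) (Sum.inl e)))
    (fun e _ h h' => (h h').map (Path.cons (G := G.double) (Sum.inr e))) p hq

theorem nonempty_walk_edge (e : G.Edge) : Nonempty (G.Walk (G.src e) (G.rng e)) :=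
  ⟨Path.cons (G := G.double) (Sum.inl e) (Path.nil _)⟩

theorem nonempty_walk_ghost (e : G.Edge) : Nonempty (G.Walk (G.rng e) (G.src e)) :=
  ⟨Path.cons (G := G.double) (Sum.inr e) (Path.nil _)⟩

theorem nonempty_walk_src_iff (a : G.Vert) (e : G.Edge) :
    Nonempty (G.Walk a (G.src e)) ↔ Nonempty (G.Walk a (G.rng e)) :=
  ⟨fun ⟨p⟩ => p.nonempty_trans (nonempty_walk_edge e),
    fun ⟨p⟩ => p.nonempty_trans (nonempty_walk_ghost e)⟩

theorem nonempty_walk_refl (a : G.Vert) : Nonempty (G.Walk a a) := ⟨Path.nil _⟩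

theorem Walk.nonempty_symm {a b : G.Vert} (p : G.Walk a b) : Nonempty (G.Walk b a) :=
  (p.iff_of_edge (Q := fun v => Nonempty (G.Walk b v)) (nonempty_walk_src_iff b)).2
    (nonempty_walk_refl b)

/-- The connected component of a vertex. -/
def component (G : DirGraph.{u}) (a : G.Vert) : DirGraph.{u} where
  Vert := {v : G.Vert // Nonempty (G.Walk a v)}
  Edge := {e : G.Edge // Nonempty (G.Walk a (G.src e))}
  src := fun e => ⟨G.src e.1, e.2⟩
  rng := fun e => ⟨G.rng e.1, (nonempty_walk_src_iff a e.1).1 e.2⟩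

/-- Instead of lifting walks, the property of being reachable from `a` inside the component is
carried along the edges of `G`. -/
theorem component_isConnected (a : G.Vert) : (G.component a).IsConnected := by
  have key : ∀ v : (G.component a).Vert,
      Nonempty ((G.component a).Walk ⟨a, nonempty_walk_refl a⟩ v) := by
    rintro ⟨v, ⟨p⟩⟩
    have hv := (p.iff_of_edge (Q := fun v => ∃ h : Nonempty (G.Walk a v),
      Nonempty ((G.component a).Walk ⟨a, nonempty_walk_refl a⟩ ⟨v, h⟩)) fun e => ?_).1
      ⟨nonempty_walk_refl a, nonempty_walk_refl _⟩
    · exact hv.2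
    · constructor
      · rintro ⟨h, hw⟩
        exact ⟨_, (nonempty_walk_src_iff (G := G.component a) _ ⟨e, h⟩).1 hw⟩
      · rintro ⟨h, hw⟩
        have h' := (nonempty_walk_src_iff a e).2 h
        exact ⟨h', (nonempty_walk_src_iff (G := G.component a) _ ⟨e, h'⟩).2 hw⟩
  refine ⟨⟨⟨a, nonempty_walk_refl a⟩⟩, fun v v' => ?_⟩
  obtain ⟨p⟩ := key v
  obtain ⟨q⟩ := p.nonempty_symm
  exact q.nonempty_trans (key v')

/-! ### Skew products and potentials -/

/-- The skew product of a graph with a group, along a labelling of the edges. -/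
def skewProduct (G : DirGraph.{u}) {A : Type u} [Group A] (c : G.Edge → A) : DirGraph.{u} where
  Vert := G.Vert × A
  Edge := G.Edge × A
  src := fun e => (G.src e.1, e.2)
  rng := fun e => (G.rng e.1, e.2 * c e.1)

/-- The connected components of a skew product of `G` are coverings of `G`. -/
def skewCovering {A : Type u} [Group A] (c : G.Edge → A) (a : (G.skewProduct c).Vert) :
    Covering G where
  graph := (G.skewProduct c).component a
  hom :=
    { onVert := fun v => v.1.1
      onEdge := fun e => e.1.1
      src_onEdge := fun _ => rfl
      rng_onEdge := fun _ => rfl }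
  connected := component_isConnected a
  bijOn_src := by
    rintro ⟨⟨v, g⟩, hv⟩
    refine ⟨?_, ?_, ?_⟩
    · rintro _ he
      exact congrArg (fun w => w.1.1) he
    · rintro ⟨⟨e, h⟩, he⟩ hs ⟨⟨e', h'⟩, he'⟩ hs' (rfl : e = e')
      have h1 : h = g := congrArg (fun w => w.1.2) hs
      have h2 : h' = g := congrArg (fun w => w.1.2) hs'
      subst h1 h2
      rfl
    · rintro e (rfl : G.src e = v)
      exact ⟨⟨(e, g), hv⟩, rfl, rfl⟩
  bijOn_rng := by
    rintro ⟨⟨v, g⟩, hv⟩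
    refine ⟨?_, ?_, ?_⟩
    · rintro _ he
      exact congrArg (fun w => w.1.1) he
    · rintro ⟨⟨e, h⟩, he⟩ hs ⟨⟨e', h'⟩, he'⟩ hs' (rfl : e = e')
      have h1 : h * c e = g := congrArg (fun w => w.1.2) hs
      have h2 : h' * c e = g := congrArg (fun w => w.1.2) hs'
      obtain rfl := mul_right_cancel (h1.trans h2.symm)
      rfl
    · rintro e (rfl : G.rng e = v)
      -- An edge carries the group coordinate of its source, so the lift of `e` ending at level `g`
      -- has coordinate `g * (c e)⁻¹`.
      have hr : (G.skewProduct c).rng (e, g * (c e)⁻¹) = (G.rng e, g) := by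
        simp [skewProduct]
      exact ⟨⟨(e, g * (c e)⁻¹), (nonempty_walk_src_iff a _).2 (by rw [hr]; exact hv)⟩,
        Subtype.ext hr, rfl⟩

/-- Every labelling of the edges of `G` by elements of a group has a potential on a universal
covering of `G`. -/
theorem Covering.IsUniversal.exists_potential {T : Covering G} (hT : T.IsUniversal) {A : Type u}
    [Group A] (c : G.Edge → A) : ∃ p : T.graph.Vert → A,
      ∀ f, p (T.graph.rng f) = p (T.graph.src f) * c (T.hom.onEdge f) := by
  obtain ⟨t⟩ := T.connected.1
  -- The base vertex only selects a component. The group coordinate of `α` is the potential, and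
  -- `hα` identifies the label under `α` with the label under `T.hom`.
  obtain ⟨α, hα⟩ := hT (skewCovering c (T.hom.onVert t, 1))
  refine ⟨fun v => (α.onVert v).1.2, fun f => ?_⟩
  have hs : (α.onEdge f).1.2 = (α.onVert (T.graph.src f)).1.2 :=
    congrArg (fun w => w.1.2) (α.src_onEdge f)
  have hr : (α.onEdge f).1.2 * c (α.onEdge f).1.1 = (α.onVert (T.graph.rng f)).1.2 :=
    congrArg (fun w => w.1.2) (α.rng_onEdge f)
  have he : (α.onEdge f).1.1 = T.hom.onEdge f := congrArg (fun β => Hom.onEdge β f) hα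
  exact hr.symm.trans (by rw [hs, he])

/-! ### Label words of walks and injectivity of potentials -/

/-- For a labelling `l` of the edges, `StepRel l (x, true)` relates the source and the range of
every edge with label `x`, and `StepRel l (x, false)` is the reverse relation. -/
def StepRel {X : Type*} (l : G.Edge → X) : X × Bool → G.Vert → G.Vert → Prop
  | (x, true), v, v' => ∃ f, G.src f = v ∧ G.rng f = v' ∧ l f = x
  | (x, false), v, v' => ∃ f, G.rng f = v ∧ G.src f = v' ∧ l f = x

/-- The vertices `v` and `v'` are joined by a walk with the given word of labels. -/
def WordRel {X : Type*} (l : G.Edge → X) : List (X × Bool) → G.Vert → G.Vert → Prop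
  | [], v, v' => v = v'
  | x :: L, v, v' => ∃ u, StepRel l x v u ∧ WordRel l L u v'

section

variable {X : Type*} {l : G.Edge → X}

theorem wordRel_append {L L' : List (X × Bool)} {v v' : G.Vert} :
    WordRel l (L ++ L') v v' ↔ ∃ u, WordRel l L v u ∧ WordRel l L' u v' := by
  induction L generalizing v with
  | nil => simp [WordRel]
  | cons x L ih =>
    simp only [List.cons_append, WordRel, ih]
    constructor
    · rintro ⟨u, hu, u', h1, h2⟩
      exact ⟨u', ⟨u, hu, h1⟩, h2⟩
    · rintro ⟨u', ⟨u, hu, h1⟩, h2⟩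
      exact ⟨u, hu, u', h1, h2⟩

/-- At a given vertex, label and direction determine the edge, so the second step runs back along
the edge of the first. -/
theorem stepRel_backtrack
    (hs : ∀ f f', G.src f = G.src f' → l f = l f' → f = f')
    (hr : ∀ f f', G.rng f = G.rng f' → l f = l f' → f = f') {x : X} {b : Bool}
    {v u v' : G.Vert} (h : StepRel l (x, b) v u) (h' : StepRel l (x, !b) u v') : v = v' := by
  cases b
  · obtain ⟨f, rfl, rfl, rfl⟩ := h
    obtain ⟨f', h1, rfl, h2⟩ := h'
    rw [hs f f' h1.symm h2.symm]
  · obtain ⟨f, rfl, rfl, rfl⟩ := h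
    obtain ⟨f', h1, rfl, h2⟩ := h'
    rw [hr f f' h1.symm h2.symm]

/-- Each elementary reduction deletes a backtrack, which returns to its starting vertex. -/
theorem WordRel.of_red
    (hs : ∀ f f', G.src f = G.src f' → l f = l f' → f = f')
    (hr : ∀ f f', G.rng f = G.rng f' → l f = l f' → f = f') {L L' : List (X × Bool)}
    (hL : FreeGroup.Red L L') {v v' : G.Vert} (h : WordRel l L v v') : WordRel l L' v v' := by
  induction hL with
  | refl => exact h
  | tail _ hstep ih =>
    cases hstep with
    | not =>
      obtain ⟨u, h1, a, ha, b, hb, h2⟩ := wordRel_append.1 ih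
      obtain rfl := stepRel_backtrack hs hr ha hb
      exact wordRel_append.2 ⟨u, h1, h2⟩

theorem Walk.exists_wordRel {p : G.Vert → FreeGroup X}
    (hp : ∀ f, p (G.rng f) = p (G.src f) * FreeGroup.of (l f)) {v v' : G.Vert}
    (q : G.Walk v v') : ∃ L, WordRel l L v v' ∧ p v' = p v * FreeGroup.mk L := by
  refine Walk.induction_rel
    (r := fun v v' => ∃ L, WordRel l L v v' ∧ p v' = p v * FreeGroup.mk L) ?_ ?_ ?_ q
  · exact fun v => ⟨[], rfl, by simp [← FreeGroup.one_eq_mk]⟩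
  · rintro e v ⟨L, hL, hpL⟩
    refine ⟨(l e, true) :: L, ⟨_, ⟨e, rfl, rfl, rfl⟩, hL⟩, ?_⟩
    rw [hpL, hp e, mul_assoc]
    rfl
  · rintro e v ⟨L, hL, hpL⟩
    refine ⟨(l e, false) :: L, ⟨_, ⟨e, rfl, rfl, rfl⟩, hL⟩, ?_⟩
    rw [hpL, hp e, mul_assoc]
    exact congrArg _ (mul_inv_cancel_left (FreeGroup.of (l e)) (FreeGroup.mk L)).symm

/-- A potential with values in the free group on the labels is injective, if distinct edges with
the same source or the same range have distinct labels. -/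
theorem IsConnected.potential_injective (hG : G.IsConnected)
    (hs : ∀ f f', G.src f = G.src f' → l f = l f' → f = f')
    (hr : ∀ f f', G.rng f = G.rng f' → l f = l f' → f = f') {p : G.Vert → FreeGroup X}
    (hp : ∀ f, p (G.rng f) = p (G.src f) * FreeGroup.of (l f)) : Function.Injective p := by
  intro v v' h
  obtain ⟨q⟩ := hG.2 v v'
  obtain ⟨L, hL, hpL⟩ := q.exists_wordRel hp
  -- Equal potentials make the word of the walk trivial in the free group, so it reduces to the
  -- empty word, whose relation is equality of vertices.
  rw [h, left_eq_mul, FreeGroup.one_eq_mk, FreeGroup.Red.exact] at hpL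
  obtain ⟨L', h1, h2⟩ := hpL
  rw [FreeGroup.Red.nil_iff] at h2
  subst h2
  exact hL.of_red hs hr h1

end

end DirGraph

/-! ## Endomorphisms and left multiplications -/

namespace RepGraph

variable (K : Type w) [Field K] {S : BiSepGraph.{u}} (F : RepGraph S)

theorem edge_eq_of_src {f f' : F.graph.Edge} (hs : F.graph.src f = F.graph.src f')
    (h : F.hom.onEdge f = F.hom.onEdge f') : f = f' := by
  obtain ⟨X, hX, hfX⟩ := S.exists_mem_C (F.hom.onEdge f)
  exact F.src_inj ⟨_, hX⟩ hs hfX (h ▸ hfX)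

theorem edge_eq_of_rng {f f' : F.graph.Edge} (hr : F.graph.rng f = F.graph.rng f')
    (h : F.hom.onEdge f = F.hom.onEdge f') : f = f' := by
  obtain ⟨Y, hY, hfY⟩ := S.exists_mem_D (F.hom.onEdge f)
  exact F.rng_inj ⟨_, hY⟩ hr hfY (h ▸ hfY)

/-- A generator, as an element of the Leavitt path algebra. -/
def lpaGen (g : S.Gen) : BiSepGraph.LPA K S :=
  ⟨RingQuot.mkAlgHom K (BiSepGraph.Rel K S) (FreeAlgebra.ι K g),
    NonUnitalAlgebra.subset_adjoin K ⟨g, rfl⟩⟩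

/-- Right modules here carry no explicit scalar structure; scalars are recovered from the action of
multiples `k • v` of vertices. -/
theorem moduleV_act_smul_lpaGen (k : K) (g : S.Gen) (m : F.V K) :
    (F.moduleV K).act m (k • lpaGen K g) = k • F.sigma K g m := by
  change (F.action K (k • RingQuot.mkAlgHom K (BiSepGraph.Rel K S) (FreeAlgebra.ι K g))).unop m = _
  rw [map_smul]
  unfold action
  rw [RingQuot.liftAlgHom_mkAlgHom_apply]
  simp [freeAction]

theorem moduleV_act_lpaGen (g : S.Gen) (m : F.V K) :
    (F.moduleV K).act m (lpaGen K g) = F.sigma K g m := by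
  simpa using F.moduleV_act_smul_lpaGen K 1 g m

/-- An additive endomorphism of the right module `V(F, φ)` is `K`-linear. -/
theorem map_smul_of_map_act {P : F.V K →+ F.V K}
    (hP : ∀ m a, P ((F.moduleV K).act m a) = (F.moduleV K).act (P m) a) (k : K) (m : F.V K) :
    P (k • m) = k • P m := by
  classical
  have hsingle : ∀ (k : K) (w : F.graph.Vert),
      P (Finsupp.single w k) = k • P (Finsupp.single w 1) := by
    intro k w
    have h : ∀ k : K, P (k • Finsupp.single w 1) =
        k • F.sigmaVert K (F.hom.onVert w) (P (Finsupp.single w 1)) := by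
      intro k
      -- This element scales the basis vector `w` by `k`. The case `k = 1` then shows that `P w` is
      -- fixed by `σ_{φ(w)}`, which removes that operator.
      have h1 := hP (Finsupp.single w 1) (k • lpaGen K (Sum.inl (F.hom.onVert w)))
      rw [moduleV_act_smul_lpaGen, moduleV_act_smul_lpaGen] at h1
      simpa only [sigma, sigmaVert_single, if_true] using h1
    have h2 := h 1
    rw [one_smul, one_smul] at h2
    rw [← Finsupp.smul_single_one, h, ← h2]
  induction m using Finsupp.induction_linear with
  | zero => simp
  | add x y hx hy => rw [smul_add, map_add, map_add, hx, hy, smul_add]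
  | single w c => rw [Finsupp.smul_single, hsingle, hsingle c, smul_smul, smul_eq_mul]

/-! ### Embedding in the group algebra of the free group -/

section Potential

variable {F} {p : F.graph.Vert → FreeGroup S.graph.Edge}

/-- The linear map from `V(F, φ)` to the group algebra of the free group that is induced by a map
on the vertices of `F`. -/
noncomputable def toGroupAlgebra (p : F.graph.Vert → FreeGroup S.graph.Edge) :
    F.V K →ₗ[K] MonoidAlgebra K (FreeGroup S.graph.Edge) :=
  (MonoidAlgebra.coeffLinearEquiv K).symm.toLinearMap ∘ₗ Finsupp.lmapDomain K K p

theorem toGroupAlgebra_single (w : F.graph.Vert) :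
    toGroupAlgebra K p (Finsupp.single w 1) = MonoidAlgebra.of K _ (p w) := by
  simp [toGroupAlgebra]

theorem toGroupAlgebra_injective (hp : Function.Injective p) :
    Function.Injective (toGroupAlgebra K p) :=
  (MonoidAlgebra.coeffLinearEquiv K).symm.injective.comp (Finsupp.mapDomain_injective hp)

variable (hp : ∀ f, p (F.graph.rng f) = p (F.graph.src f) * FreeGroup.of (F.hom.onEdge f))

include hp

/-- `σ_e` kills the vertices that emit no edge over `e`, whereas right multiplication by `e` kills
nothing. Applying `σ_e` and then `σ_{e*}` first projects onto the span of the remaining vertices,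
where `σ_e` is translation by `e`. -/
theorem toGroupAlgebra_sigmaEdge (e : S.graph.Edge) (m : F.V K) :
    toGroupAlgebra K p (F.sigmaEdge K e m) =
      toGroupAlgebra K p (F.sigmaStar K e (F.sigmaEdge K e m)) *
        MonoidAlgebra.of K _ (FreeGroup.of e) := by
  suffices h : toGroupAlgebra K p ∘ₗ F.sigmaEdge K e =
      LinearMap.mulRight K (MonoidAlgebra.of K _ (FreeGroup.of e)) ∘ₗ toGroupAlgebra K p ∘ₗ
        F.sigmaStar K e ∘ₗ F.sigmaEdge K e from LinearMap.congr_fun h m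
  refine Finsupp.lhom_ext' fun w => LinearMap.ext_ring ?_
  simp only [LinearMap.comp_apply, Finsupp.lsingle_apply, LinearMap.mulRight_apply]
  by_cases hf : ∃ f, F.graph.src f = w ∧ F.hom.onEdge f = e
  · obtain ⟨f, rfl, rfl⟩ := hf
    rw [sigmaEdge_single, sigmaStar_single, toGroupAlgebra_single, toGroupAlgebra_single, hp,
      map_mul]
  · rw [F.sigmaEdge_single_zero K hf, map_zero, map_zero, map_zero, zero_mul]

theorem toGroupAlgebra_sigmaStar (e : S.graph.Edge) (m : F.V K) :
    toGroupAlgebra K p (F.sigmaStar K e m) =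
      toGroupAlgebra K p (F.sigmaEdge K e (F.sigmaStar K e m)) *
        MonoidAlgebra.of K _ (FreeGroup.of e)⁻¹ := by
  suffices h : toGroupAlgebra K p ∘ₗ F.sigmaStar K e =
      LinearMap.mulRight K (MonoidAlgebra.of K _ (FreeGroup.of e)⁻¹) ∘ₗ toGroupAlgebra K p ∘ₗ
        F.sigmaEdge K e ∘ₗ F.sigmaStar K e from LinearMap.congr_fun h m
  refine Finsupp.lhom_ext' fun w => LinearMap.ext_ring ?_
  simp only [LinearMap.comp_apply, Finsupp.lsingle_apply, LinearMap.mulRight_apply]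
  by_cases hf : ∃ f, F.graph.rng f = w ∧ F.hom.onEdge f = e
  · obtain ⟨f, rfl, rfl⟩ := hf
    rw [sigmaStar_single, sigmaEdge_single, toGroupAlgebra_single, toGroupAlgebra_single, hp,
      ← map_mul, mul_inv_cancel_right]
  · rw [F.sigmaStar_single_zero K hf, map_zero, map_zero, map_zero, zero_mul]

/-- Under `toGroupAlgebra`, every endomorphism of the right module `V(F, φ)` becomes a left
multiplication. -/
theorem exists_toGroupAlgebra_eq_mul {P : F.V K →+ F.V K}
    (hP : ∀ m a, P ((F.moduleV K).act m a) = (F.moduleV K).act (P m) a) :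
    ∃ a, ∀ m, toGroupAlgebra K p (P m) = a * toGroupAlgebra K p m := by
  have hedge : ∀ e m, P (F.sigmaEdge K e m) = F.sigmaEdge K e (P m) := fun e m => by
    have h := hP m (lpaGen K (Sum.inr (Sum.inl e)))
    rwa [moduleV_act_lpaGen, moduleV_act_lpaGen] at h
  have hstar : ∀ e m, P (F.sigmaStar K e m) = F.sigmaStar K e (P m) := fun e m => by
    have h := hP m (lpaGen K (Sum.inr (Sum.inr e)))
    rwa [moduleV_act_lpaGen, moduleV_act_lpaGen] at h
  obtain ⟨t₀⟩ := F.connected.1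
  -- The only choice that makes the formula true at `t₀`.
  let a := toGroupAlgebra K p (P (Finsupp.single t₀ 1)) * MonoidAlgebra.of K _ (p t₀)⁻¹
  have hsingle : ∀ t, toGroupAlgebra K p (P (Finsupp.single t 1)) =
      a * MonoidAlgebra.of K _ (p t) := by
    intro t
    obtain ⟨q⟩ := F.connected.2 t₀ t
    refine (q.iff_of_edge (Q := fun t => toGroupAlgebra K p (P (Finsupp.single t 1)) =
      a * MonoidAlgebra.of K _ (p t)) fun f => ⟨fun h => ?_, fun h => ?_⟩).1 ?_
    -- The projection fixes the source of `f`, hence also its image under `P`, since `P` commutes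
    -- with both operators. Thus passing from source to range multiplies both sides by the label of
    -- `f`.
    · have h1 := toGroupAlgebra_sigmaEdge K hp (F.hom.onEdge f)
        (P (Finsupp.single (F.graph.src f) 1))
      rw [← hedge, ← hstar, sigmaEdge_single, sigmaStar_single, h, mul_assoc, ← map_mul,
        ← hp] at h1
      exact h1
    · have h1 := toGroupAlgebra_sigmaStar K hp (F.hom.onEdge f)
        (P (Finsupp.single (F.graph.rng f) 1))
      rw [← hstar, ← hedge, sigmaStar_single, sigmaEdge_single, h, mul_assoc, ← map_mul, hp,
        mul_inv_cancel_right] at h1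
      exact h1
    · simp only [a]
      rw [mul_assoc, ← map_mul, inv_mul_cancel, map_one, mul_one]
  let P' : F.V K →ₗ[K] F.V K := { P with map_smul' := F.map_smul_of_map_act K hP }
  refine ⟨a, fun m => ?_⟩
  suffices h : toGroupAlgebra K p ∘ₗ P' = LinearMap.mulLeft K a ∘ₗ toGroupAlgebra K p from
    LinearMap.congr_fun h m
  refine Finsupp.lhom_ext' fun w => LinearMap.ext_ring ?_
  simp only [LinearMap.comp_apply, Finsupp.lsingle_apply, LinearMap.mulLeft_apply,
    toGroupAlgebra_single]
  exact hsingle w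

/-- The projection onto `U` along `W` is an endomorphism, so it becomes left multiplication by some
`a`. Idempotency gives `a * (a - 1) = 0`; then `a = 0` forces `U = ⊥` and `a = 1` forces `W = ⊥`. -/
theorem isIndecomposable_of_potential (hinj : Function.Injective p) :
    (F.moduleV K).IsIndecomposable := by
  obtain ⟨t₀⟩ := F.connected.1
  refine ⟨⟨Finsupp.single t₀ 1, 0, by simp⟩, fun U W hU hW hUW => ?_⟩
  -- The summands are only additive subgroups, so the projection is taken over `ℤ`.
  have hUW' : IsCompl (AddSubgroup.toIntSubmodule U) (AddSubgroup.toIntSubmodule W) :=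
    (AddSubgroup.toIntSubmodule (M := F.V K)).isCompl hUW
  let P : F.V K →+ F.V K := (Submodule.projection _ _ hUW').toAddMonoidHom
  have hPU : ∀ m ∈ U, P m = m := fun m hm => Submodule.projection_apply_of_mem_left hUW' hm
  have hPW : ∀ m ∈ W, P m = 0 := fun m hm => Submodule.projection_apply_of_mem_right hUW' hm
  have hPmem : ∀ m, P m ∈ U := fun m => Submodule.projection_apply_mem hUW' m
  have hsub : ∀ m, m - P m ∈ W := fun m => Submodule.sub_projection_mem hUW' m
  have hP : ∀ m a, P ((F.moduleV K).act m a) = (F.moduleV K).act (P m) a := by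
    intro m a
    have h : (F.moduleV K).act m a =
        (F.moduleV K).act (P m) a + (F.moduleV K).act (m - P m) a := by
      rw [← (F.moduleV K).add_act, add_sub_cancel]
    rw [h, map_add, hPU _ (hU _ (hPmem m) a), hPW _ (hW _ (hsub m) a), add_zero]
  obtain ⟨a, ha⟩ := exists_toGroupAlgebra_eq_mul K hp hP
  have hΦ := toGroupAlgebra_injective K hinj
  have hPP := ha (P (Finsupp.single t₀ 1))
  rw [hPU _ (hPmem _), ha, toGroupAlgebra_single] at hPP
  have haa : a * (a - 1) = 0 := by
    -- Idempotency tested at `t₀` suffices, because `p t₀` is a unit of the group algebra.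
    have h := congrArg (· * MonoidAlgebra.of K _ (p t₀)⁻¹) hPP
    simp only [mul_assoc, ← map_mul, mul_inv_cancel, map_one, mul_one] at h
    rw [mul_sub, mul_one, ← h, sub_self]
  rcases mul_eq_zero.1 haa with h | h
  · refine Or.inl ((AddSubgroup.eq_bot_iff_forall _).2 fun m hm => hΦ ?_)
    rw [← hPU m hm, ha, h, zero_mul, map_zero]
  · refine Or.inr ((AddSubgroup.eq_bot_iff_forall _).2 fun m hm => hΦ ?_)
    rw [← one_mul (toGroupAlgebra K p m), ← sub_eq_zero.1 h, ← ha, hPW m hm]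

end Potential

end RepGraph

theorem theorem5p8 {K : Type w} [Field K] (S : BiSepGraph.{u})
    (𝒞 : ConnectedComponents (RepGraph S)) (F : RepGraph S)
    (hF : (Quotient.mk (Zigzag.setoid (RepGraph S)) F : ConnectedComponents (RepGraph S)) = 𝒞)
    (T : DirGraph.Covering F.graph) (hT : T.IsUniversal) :
    ((F.ofCovering T).moduleV K).IsIndecomposable := by
  obtain ⟨p, hp⟩ := hT.exists_potential fun f => FreeGroup.of (F.hom.onEdge f)
  exact RepGraph.isIndecomposable_of_potential K (F := F.ofCovering T) hp
    (T.connected.potential_injective (fun _ _ => (F.ofCovering T).edge_eq_of_src)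
      (fun _ _ => (F.ofCovering T).edge_eq_of_rng) hp)
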